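/- All graphs are finite and simple. For a graph $\Gamma=(V,E)$ let $N(v)$ be the neighbourhood of $v$; $\Gamma$ is \emph{reduced} if $N(v)=N(w)$ implies $v=w$. For a reduced $\Gamma$, let $\mathrm{Aut}^{\pi}(\Gamma)$ be the group of permutations $\pi$ of $V$ that map every neighbourhood onto a neighbourhood, and let $\gamma$ be the automorphism of $\mathrm{Aut}^{\pi}(\Gamma)$ determined by $\pi(N(v))=N(\gamma(\pi)(v))$ for all $v\in V$; it satisfies $\gamma^2=\mathrm{id}$. Let $B\Gamma$ be the canonical double cover, with vertex set $V\times\{0,1\}$ and $(v,i)$ adjacent to $(w,j)$ if and only if $i\ne j$ and $\{v,w\}\in E$. A \emph{strongly switching element} of $\Gamma$ is an element of order two of $\mathrm{Aut}(B\Gamma)$ that exchanges $V\times\{0\}$ and $V\times\{1\}$ and maps no vertex of $B\Gamma$ to one of its neighbours. Let $H$ be a finite group and $\sigma\in\mathrm{Aut}(H)$ with $\sigma^2=\mathrm{id}$. Let $H\rtimes\mathbb{Z}_2$ be the semidirect product in which the nontrivial element $x$ of $\mathbb{Z}_2=\{e,x\}$ acts on $H$ as $\sigma$, and put $S(H,\sigma)=\{g\in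 (H\rtimes\mathbb{Z}_2)\setminus H : g^2=e\}$. Call a subset $\mathcal{C}\subseteq S(H,\sigma)$ \emph{achievable} if there are a connected, reduced, nonbipartite graph $\Gamma$, an isomorphism $\psi:\mathrm{Aut}^{\pi}(\Gamma)\to H$ with $\sigma=\psi\circ\gamma\circ\psi^{-1}$, and an isomorphism $\Psi:\mathrm{Aut}(B\Gamma)\to H\rtimes\mathbb{Z}_2$ such that - for every $\pi\in\mathrm{Aut}^{\pi}(\Gamma)$, $\Psi$ sends the automorphism $(v,0)\mapsto(\pi(v),0)$, $(v,1)\mapsto(\gamma(\pi)(v),1)$ of $B\Gamma$ to $\psi(\pi)\in H$; - $\Psi$ sends the automorphism $(v,i)\mapsto(v,1-i)$ of $B\Gamma$ to $x$; - $\mathcal{C}$ is exactly the image under $\Psi$ of the set of strongly switching elements of $\Gamma$. **Theorem.** Let $\mathcal{C}\subseteq S(H,\sigma)$ be a union of conjugacy classes of $H\rtimes\mathbb{Z}_2$ with $x\in\mathcal{C}$. Then $\mathcal{C}$ is achievable. -/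

import Mathlib

universe u

namespace TwoFold

section Graph

variable {V : Type u}

/-- A graph is reduced (twin free) if distinct vertices have distinct neighbourhoods. -/
def Reduced (Γ : SimpleGraph V) : Prop :=
  ∀ v w : V, Γ.neighborSet v = Γ.neighborSet w → v = w

/-- The group `Aut^π(Γ)` of two-fold projections of a finite graph: the permutations `π` of the
vertices which map every neighbourhood onto a neighbourhood. -/
def autPi [Finite V] (Γ : SimpleGraph V) : Subgroup (Equiv.Perm V) where
  carrier := {π | ∀ v : V, ∃ w : V, π '' Γ.neighborSet v = Γ.neighborSet w}
  one_mem' v := ⟨v, by simp⟩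
  mul_mem' := by
    intro π τ hπ hτ v
    obtain ⟨w, hw⟩ := hτ v
    obtain ⟨w', hw'⟩ := hπ w
    exact ⟨w', by rw [← hw', ← hw, Equiv.Perm.coe_mul, Set.image_comp]⟩
  inv_mem' := by
    intro π hπ v
    have hmaps : Set.MapsTo (fun s : Set V => π '' s) (Set.range Γ.neighborSet)
        (Set.range Γ.neighborSet) := by
      rintro _ ⟨w, rfl⟩
      obtain ⟨w', hw'⟩ := hπ w
      exact ⟨w', hw'.symm⟩
    have hinj : Set.InjOn (fun s : Set V => π '' s) (Set.range Γ.neighborSet) :=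
      (Set.image_injective.2 π.injective).injOn
    have hsurj := ((Set.toFinite _).injOn_iff_bijOn_of_mapsTo hmaps).1 hinj |>.surjOn
    obtain ⟨_, ⟨w, rfl⟩, hw⟩ := hsurj (Set.mem_range_self v)
    refine ⟨w, ?_⟩
    have hw2 : π '' Γ.neighborSet w = Γ.neighborSet v := hw
    rw [← hw2, ← Set.image_comp, ← Equiv.Perm.coe_mul]
    simp

variable [Finite V] {Γ : SimpleGraph V}

/-- The vertex `γ(π)(v)`, i.e. a vertex `w` with `π(N(v)) = N(w)`. It is unique if `Γ` is
reduced. -/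
noncomputable def gammaFun (π : autPi Γ) (v : V) : V := Classical.choose (π.2 v)

theorem image_neighborSet (π : autPi Γ) (v : V) :
    (π : Equiv.Perm V) '' Γ.neighborSet v = Γ.neighborSet (gammaFun π v) :=
  Classical.choose_spec (π.2 v)

theorem gammaFun_eq (hΓ : Reduced Γ) (π : autPi Γ) {v w : V}
    (h : (π : Equiv.Perm V) '' Γ.neighborSet v = Γ.neighborSet w) : gammaFun π v = w :=
  hΓ _ _ (by rw [← image_neighborSet, h])

theorem gammaFun_mul (hΓ : Reduced Γ) (π τ : autPi Γ) (v : V) :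
    gammaFun (π * τ) v = gammaFun π (gammaFun τ v) := by
  apply gammaFun_eq hΓ
  rw [← image_neighborSet, ← image_neighborSet, Subgroup.coe_mul, Equiv.Perm.coe_mul,
    Set.image_comp]

theorem gammaFun_one (hΓ : Reduced Γ) (v : V) : gammaFun (1 : autPi Γ) v = v :=
  gammaFun_eq hΓ _ (by simp)

theorem adj_iff (π : autPi Γ) (v w : V) :
    Γ.Adj ((π : Equiv.Perm V) v) (gammaFun π w) ↔ Γ.Adj v w := by
  have h : (π : Equiv.Perm V) v ∈ Γ.neighborSet (gammaFun π w) ↔ v ∈ Γ.neighborSet w := by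
    rw [← image_neighborSet]
    exact (π : Equiv.Perm V).injective.mem_set_image
  rw [SimpleGraph.mem_neighborSet, SimpleGraph.mem_neighborSet] at h
  rw [Γ.adj_comm, h, Γ.adj_comm]

/-- `γ(π)` as a permutation of the vertices of a reduced graph. -/
noncomputable def gammaPerm (hΓ : Reduced Γ) (π : autPi Γ) : Equiv.Perm V where
  toFun := gammaFun π
  invFun := gammaFun π⁻¹
  left_inv v := by rw [← gammaFun_mul hΓ, inv_mul_cancel, gammaFun_one hΓ]
  right_inv v := by rw [← gammaFun_mul hΓ, mul_inv_cancel, gammaFun_one hΓ]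

theorem gammaPerm_image (hΓ : Reduced Γ) (π : autPi Γ) (v : V) :
    gammaPerm hΓ π '' Γ.neighborSet v = Γ.neighborSet ((π : Equiv.Perm V) v) := by
  ext w
  obtain ⟨w, rfl⟩ := (gammaPerm hΓ π).surjective w
  rw [(gammaPerm hΓ π).injective.mem_set_image, SimpleGraph.mem_neighborSet,
    SimpleGraph.mem_neighborSet]
  exact (adj_iff π v w).symm

/-- `γ(π)` as a two-fold projection. -/
noncomputable def gammaPi (hΓ : Reduced Γ) (π : autPi Γ) : autPi Γ :=
  ⟨gammaPerm hΓ π, fun v => ⟨(π : Equiv.Perm V) v, gammaPerm_image hΓ π v⟩⟩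

theorem gammaPi_gammaPi (hΓ : Reduced Γ) (π : autPi Γ) : gammaPi hΓ (gammaPi hΓ π) = π := by
  ext v
  exact gammaFun_eq hΓ _ (gammaPerm_image hΓ π v)

/-- The involutive automorphism `γ` of `Aut^π(Γ)`, for a reduced graph `Γ`; it is determined by
`π(N(v)) = N(γ(π)(v))`. -/
noncomputable def gamma (hΓ : Reduced Γ) : MulAut (autPi Γ) where
  toFun := gammaPi hΓ
  invFun := gammaPi hΓ
  left_inv := gammaPi_gammaPi hΓ
  right_inv := gammaPi_gammaPi hΓ
  map_mul' π τ := by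
    ext v
    exact gammaFun_mul hΓ π τ v

/-- The automorphism of the canonical double cover `BΓ` given by a two-fold projection `π`:
it acts as `π` on the first copy of `V` and as `γ(π)` on the second. -/
noncomputable def liftB (hΓ : Reduced Γ) (π : autPi Γ) :
    Γ.bipartiteDoubleCover ≃g Γ.bipartiteDoubleCover where
  toEquiv := Equiv.sumCongr (π : Equiv.Perm V) (gamma hΓ π : Equiv.Perm V)
  map_rel_iff' := by
    rintro (v | v) (w | w)
    · exact Iff.rfl
    · exact adj_iff π v w
    · exact (Γ.adj_comm _ _).trans ((adj_iff π w v).trans (Γ.adj_comm _ _))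
    · exact Iff.rfl

/-- The automorphism of `BΓ` which exchanges the two copies of every vertex. -/
def swapB (Γ : SimpleGraph V) : Γ.bipartiteDoubleCover ≃g Γ.bipartiteDoubleCover where
  toEquiv := Equiv.sumComm V V
  map_rel_iff' := by
    rintro (v | v) (w | w) <;> exact Iff.rfl

/-- `S(Γ)`: the automorphisms of `BΓ` of order two which switch its two parts. -/
def switching (Γ : SimpleGraph V) :
    Set (Γ.bipartiteDoubleCover ≃g Γ.bipartiteDoubleCover) :=
  {g | orderOf g = 2 ∧ (∀ v : V, ∃ w : V, g (Sum.inl v) = Sum.inr w) ∧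
    (∀ v : V, ∃ w : V, g (Sum.inr v) = Sum.inl w)}

/-- The strongly switching elements of `Γ`: the elements of `S(Γ)` which map every vertex of `BΓ`
to a vertex outside of its neighbourhood. -/
def stronglySwitching (Γ : SimpleGraph V) :
    Set (Γ.bipartiteDoubleCover ≃g Γ.bipartiteDoubleCover) :=
  {g | g ∈ switching Γ ∧ ∀ p, g p ∉ Γ.bipartiteDoubleCover.neighborSet p}

end Graph

section Group

variable {H : Type u} [Group H]

/-- The action `θ` of `ℤ₂ = {e, x}` on `H` with `θ(x) = σ`. -/
def theta (σ : MulAut H) (hσ : σ ^ 2 = 1) : Multiplicative (ZMod 2) →* MulAut H where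
  toFun z := σ ^ (Multiplicative.toAdd z).val
  map_one' := by simp
  map_mul' a b := by
    rw [← pow_add, toAdd_mul, ZMod.val_add]
    exact (pow_eq_pow_mod _ hσ).symm

/-- The semidirect product `H ⋊ ℤ₂` in which the nontrivial element of `ℤ₂` acts as `σ`. -/
abbrev HZ2 (σ : MulAut H) (hσ : σ ^ 2 = 1) : Type u :=
  H ⋊[theta σ hσ] Multiplicative (ZMod 2)

/-- The element `x` (the nontrivial element of `ℤ₂`) of `H ⋊ ℤ₂`. -/
def xElt (σ : MulAut H) (hσ : σ ^ 2 = 1) : HZ2 σ hσ :=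
  SemidirectProduct.inr (Multiplicative.ofAdd 1)

/-- `S(H, σ)`: the elements of `H ⋊ ℤ₂` outside of `H` whose square is trivial. -/
def S (σ : MulAut H) (hσ : σ ^ 2 = 1) : Set (HZ2 σ hσ) :=
  {g | g ∉ (SemidirectProduct.inl : H →* HZ2 σ hσ).range ∧ g ^ 2 = 1}

/-- A set which is a union ("sum") of conjugacy classes of the group. -/
def IsSumOfConjClasses {G : Type u} [Group G] (C : Set G) : Prop :=
  ∃ K : Set (ConjClasses G), C = ⋃ c ∈ K, c.carrier

/-- `ψ` is an isomorphism `Aut^π(Γ) ≅ H` with `σ = ψ ∘ γ ∘ ψ⁻¹`. -/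
def Intertwines (σ : MulAut H) {V : Type u} [Finite V] {Γ : SimpleGraph V} (hΓ : Reduced Γ)
    (ψ : autPi Γ ≃* H) : Prop :=
  ∀ h : H, σ h = ψ (gamma hΓ (ψ.symm h))

/-- `Γ` achieves `C`: `Γ` is an `(H, σ)`-graph, i.e. it is reduced and there is an isomorphism
`ψ : Aut^π(Γ) ≅ H` with `σ = ψ ∘ γ ∘ ψ⁻¹`, and, for such a `ψ`, the set `C` is
exactly the image of the set of strongly switching elements under the isomorphism
`Ψ : Aut(BΓ) ≅ H ⋊ ℤ₂` which corresponds to `ψ`, i.e. which sends the automorphism of `BΓ` given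
by `π ∈ Aut^π(Γ)` to `ψ(π) ∈ H` and the exchange of the two copies of `V` to `x`. -/
def Achieves (σ : MulAut H) (hσ : σ ^ 2 = 1) {V : Type u} [Finite V] (Γ : SimpleGraph V)
    (C : Set (HZ2 σ hσ)) : Prop :=
  ∃ (hΓ : Reduced Γ) (ψ : autPi Γ ≃* H), Intertwines σ hΓ ψ ∧
    ∃ Ψ : (Γ.bipartiteDoubleCover ≃g Γ.bipartiteDoubleCover) ≃* HZ2 σ hσ,
      (∀ π : autPi Γ, Ψ (liftB hΓ π) = SemidirectProduct.inl (ψ π)) ∧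
      Ψ (swapB Γ) = xElt σ hσ ∧
      Ψ '' stronglySwitching Γ = C

/-- `C` is achievable: some finite connected reduced nonbipartite graph achieves it. -/
def Achievable (σ : MulAut H) (hσ : σ ^ 2 = 1) (C : Set (HZ2 σ hσ)) : Prop :=
  ∃ (V : Type u) (_ : Finite V) (Γ : SimpleGraph V),
    Γ.Connected ∧ Reduced Γ ∧ ¬ Γ.IsBipartite ∧ Achieves σ hσ Γ C

end Group

end TwoFold

/-!
The graph is a voltage graph on `H × Colour n`, on which `H` acts by left multiplication. For
colours `k`, `k'` there is a set of voltages in `H`, and `(h, k)` is adjacent to `(h', k')` if and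
only if `h⁻¹ * σ h'` is one of these voltages. Hence left multiplication by `g` is a two-fold
projection `L g` with `γ (L g) = L (σ g)`, and so `H ⋊ ℤ₂` acts on `BΓ`. For a pair of distinct
colours there is at most one voltage. The set `T` of voltages from the colour `c 0` to itself is
the set of all `g` for which `g x` is an involution outside of the given union `C` of conjugacy
classes; all other colours have no voltages to themselves. An involution `g x` maps `(h, k)` in
the first part to a neighbour if and only if `k = c 0` and `h⁻¹ * g * σ h ∈ T`, that is, if and
only if `k = c 0` and `g ∈ T`, because `C` is closed under conjugation
(`liftB_mul_swapB_mem_stronglySwitching_iff`). So the strongly switching elements in `H ⋊ ℤ₂` are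
exactly the elements of `C`. As `x ∈ C`, the graph has no loops.

It remains to see that `BΓ` has no further automorphisms. The colours are chosen such that they
can be recognized by the degrees of a vertex and of its neighbours
(`colour_eq_of_colourDegree_eq`), so that two-fold projections preserve colours. A function on the
vertices of `BΓ` which is constant on the edges joining distinct colours is constant
(`eq_of_adj_voltageGraph`), since every element of `H` is the voltage from `m` to some `c i` while
the other voltages between distinct `c i` and `d j` are trivial, and since there is a triangle
with the colours `c 0`, `c 1` and `d 1`. Applied to connected components, this shows that `BΓ` is
connected, so that every automorphism of `BΓ` preserves the parts or exchanges them and is given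
by a two-fold projection up to the exchange (`exists_liftB_or_liftB_mul_swapB`). Applied to the
quotients `h' * h⁻¹`, where `π(h, k) = (h', k)`, it shows that a two-fold projection `π` is a left
multiplication (`exists_apply_autPi_eq`).
-/

namespace TwoFold

/-! ### Automorphisms of the canonical double cover -/

section DoubleCover

variable {V : Type u} {Γ : SimpleGraph V}

theorem bipartiteDoubleCover_adj_inl_inr {v w : V} :
    Γ.bipartiteDoubleCover.Adj (Sum.inl v) (Sum.inr w) ↔ Γ.Adj v w := Iff.rfl

theorem bipartiteDoubleCover_adj_inr_inl {v w : V} :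
    Γ.bipartiteDoubleCover.Adj (Sum.inr v) (Sum.inl w) ↔ Γ.Adj v w := Iff.rfl

theorem eq_of_preconnected_of_adj {W X : Type*} {G : SimpleGraph W} (hG : G.Preconnected)
    {F : W → X} (hF : ∀ p q, G.Adj p q → F p = F q) (p q : W) : F p = F q := by
  obtain ⟨w⟩ := hG p q
  induction w with
  | nil => rfl
  | cons h _ ih => exact (hF _ _ h).trans ih

theorem connected_of_bipartiteDoubleCover (h : Γ.bipartiteDoubleCover.Connected) :
    Γ.Connected := by
  have : Nonempty V := h.nonempty.elim fun p => ⟨p.elim id id⟩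
  refine ⟨fun v w => ?_⟩
  let f : Γ.bipartiteDoubleCover →g Γ :=
    { toFun := Sum.elim id id
      map_rel' := by
        rintro (v | v) (w | w) hvw
        · exact hvw.elim
        · exact hvw
        · exact hvw
        · exact hvw.elim }
  exact (h.preconnected (Sum.inl v) (Sum.inl w)).map f

theorem swapB_inl (v : V) : swapB Γ (Sum.inl v) = Sum.inr v := rfl

theorem swapB_inr (v : V) : swapB Γ (Sum.inr v) = Sum.inl v := rfl

theorem swapB_mul_swapB : swapB Γ * swapB Γ = 1 := by
  ext (v | v) <;> rfl

variable [Finite V]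

theorem mem_autPi_of_adj {α β : Equiv.Perm V} (h : ∀ v w, Γ.Adj (α v) (β w) ↔ Γ.Adj v w) :
    α ∈ autPi Γ := by
  refine fun w => ⟨β w, ?_⟩
  ext v
  obtain ⟨v, rfl⟩ := α.surjective v
  rw [α.injective.mem_set_image, SimpleGraph.mem_neighborSet, SimpleGraph.mem_neighborSet,
    Γ.adj_comm, ← h, Γ.adj_comm]

theorem gamma_eq_of_adj (hΓ : Reduced Γ) (π : autPi Γ) {β : Equiv.Perm V}
    (h : ∀ v w, Γ.Adj ((π : Equiv.Perm V) v) (β w) ↔ Γ.Adj v w) :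
    (gamma hΓ π : Equiv.Perm V) = β := by
  ext w
  refine gammaFun_eq hΓ π ?_
  ext v
  obtain ⟨v, rfl⟩ := (π : Equiv.Perm V).surjective v
  rw [(π : Equiv.Perm V).injective.mem_set_image, SimpleGraph.mem_neighborSet,
    SimpleGraph.mem_neighborSet, Γ.adj_comm, ← h, Γ.adj_comm]

/-- `π ↦ liftB π` as a homomorphism `Aut^π(Γ) → Aut(BΓ)`. -/
noncomputable def liftHom (hΓ : Reduced Γ) :
    autPi Γ →* (Γ.bipartiteDoubleCover ≃g Γ.bipartiteDoubleCover) where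
  toFun := liftB hΓ
  map_one' := by
    ext (v | v)
    · rfl
    · exact congrArg Sum.inr (gammaFun_one hΓ v)
  map_mul' π τ := by
    ext (v | v)
    · rfl
    · exact congrArg Sum.inr (gammaFun_mul hΓ π τ v)

theorem liftB_inl (hΓ : Reduced Γ) (π : autPi Γ) (v : V) :
    liftB hΓ π (Sum.inl v) = Sum.inl ((π : Equiv.Perm V) v) := rfl

theorem liftB_inr (hΓ : Reduced Γ) (π : autPi Γ) (v : V) :
    liftB hΓ π (Sum.inr v) = Sum.inr ((gamma hΓ π : Equiv.Perm V) v) := rfl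

theorem swapB_mul_liftB (hΓ : Reduced Γ) (π : autPi Γ) :
    swapB Γ * liftB hΓ π = liftB hΓ (gamma hΓ π) * swapB Γ := by
  ext (v | v)
  · exact congrArg Sum.inr
      (DFunLike.congr_fun (congrArg Subtype.val (gammaPi_gammaPi hΓ π)) v).symm
  · rfl

/-- An automorphism of `BΓ` which fixes both parts comes from a two-fold projection. -/
theorem exists_liftB_eq (hΓ : Reduced Γ)
    (g : Γ.bipartiteDoubleCover ≃g Γ.bipartiteDoubleCover)
    (hl : ∀ v, (g (Sum.inl v)).isLeft) (hr : ∀ v, (g (Sum.inr v)).isRight) :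
    ∃ π, liftB hΓ π = g := by
  choose α hα using fun v => Sum.isLeft_iff.1 (hl v)
  choose β hβ using fun v => Sum.isRight_iff.1 (hr v)
  have hαi : Function.Injective α := fun v w h =>
    Sum.inl_injective (g.injective (by rw [hα, hα, h]))
  have hβi : Function.Injective β := fun v w h =>
    Sum.inr_injective (g.injective (by rw [hβ, hβ, h]))
  let α' : Equiv.Perm V := Equiv.ofBijective α (Finite.injective_iff_bijective.1 hαi)
  let β' : Equiv.Perm V := Equiv.ofBijective β (Finite.injective_iff_bijective.1 hβi)
  have h : ∀ v w, Γ.Adj (α' v) (β' w) ↔ Γ.Adj v w := fun v w => by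
    have h1 := g.map_rel_iff (a := Sum.inl v) (b := Sum.inr w)
    rw [hα, hβ] at h1
    exact h1
  refine ⟨⟨α', mem_autPi_of_adj h⟩, ?_⟩
  ext (v | v)
  · rw [liftB_inl, hα]
    rfl
  · rw [liftB_inr, hβ, gamma_eq_of_adj hΓ ⟨α', mem_autPi_of_adj h⟩ h]
    rfl

/-- If `BΓ` is connected, then an automorphism of `BΓ` fixes both parts or exchanges them. -/
theorem exists_liftB_or_liftB_mul_swapB (hΓ : Reduced Γ)
    (hB : Γ.bipartiteDoubleCover.Connected)
    (g : Γ.bipartiteDoubleCover ≃g Γ.bipartiteDoubleCover) :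
    ∃ π, liftB hΓ π = g ∨ liftB hΓ π * swapB Γ = g := by
  have hadj : ∀ p q, Γ.bipartiteDoubleCover.Adj p q → p.isLeft = !q.isLeft := by
    rintro (v | v) (w | w) h
    · exact h.elim
    · rfl
    · rfl
    · exact h.elim
  -- Whether `g` changes the part of a vertex does not depend on the vertex.
  have hconst := eq_of_preconnected_of_adj hB.preconnected
    (F := fun p => xor p.isLeft (g p).isLeft) (fun p q h => by
      have h2 := hadj _ _ (g.map_rel_iff.2 h)
      simp only [hadj _ _ h, h2]
      cases q.isLeft <;> cases (g q).isLeft <;> rfl)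
  obtain ⟨p₀⟩ := hB.nonempty
  have hc := fun p => hconst p p₀
  cases hp : xor p₀.isLeft (g p₀).isLeft
  · simp only [hp] at hc
    obtain ⟨π, hπ⟩ := exists_liftB_eq hΓ g (fun v => by simpa using hc (Sum.inl v))
      (fun v => by simpa using hc (Sum.inr v))
    exact ⟨π, Or.inl hπ⟩
  · simp only [hp] at hc
    obtain ⟨π, hπ⟩ := exists_liftB_eq hΓ (g * swapB Γ)
      (fun v => by rw [RelIso.mul_apply, swapB_inl]; simpa using hc (Sum.inr v))
      (fun v => by rw [RelIso.mul_apply, swapB_inr]; simpa using hc (Sum.inl v))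
    exact ⟨π, Or.inr (by rw [hπ, mul_assoc, swapB_mul_swapB, mul_one])⟩

end DoubleCover

section Semidirect

variable {H : Type u} [Group H] {σ : MulAut H} {hσ : σ ^ 2 = 1}

theorem theta_ofAdd_one : theta σ hσ (Multiplicative.ofAdd 1) = σ := pow_one σ

theorem eq_inl_or_eq_inl_mul_xElt (z : HZ2 σ hσ) :
    ∃ h : H, z = SemidirectProduct.inl h ∨ z = SemidirectProduct.inl h * xElt σ hσ := by
  have h2 : ∀ t : Multiplicative (ZMod 2), t = 1 ∨ t = Multiplicative.ofAdd 1 := by decide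
  refine ⟨z.left, (h2 z.right).imp (fun h => ?_) (fun h => ?_)⟩
  · rw [← SemidirectProduct.inl_left_mul_inr_right z, h]
    simp
  · rw [xElt, ← h, SemidirectProduct.inl_left_mul_inr_right]

theorem xElt_mul_inl (h : H) :
    xElt σ hσ * SemidirectProduct.inl h = SemidirectProduct.inl (σ h) * xElt σ hσ := by
  ext <;> simp [xElt, theta_ofAdd_one]

theorem xElt_mul_xElt : xElt σ hσ * xElt σ hσ = 1 := by
  rw [xElt, ← map_mul, ← map_one SemidirectProduct.inr]
  rfl

/-- If `BΓ` is connected, an isomorphism `Aut^π(Γ) ≅ H` which carries `γ` to `σ` extends to an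
isomorphism `Aut(BΓ) ≅ H ⋊ ℤ₂`, here given by its inverse. -/
theorem exists_mulEquiv_aut_bipartiteDoubleCover {V : Type u} [Finite V] {Γ : SimpleGraph V}
    (hΓ : Reduced Γ) (hB : Γ.bipartiteDoubleCover.Connected) (ψ : autPi Γ ≃* H)
    (hψ : Intertwines σ hΓ ψ) :
    ∃ Φ : HZ2 σ hσ ≃* (Γ.bipartiteDoubleCover ≃g Γ.bipartiteDoubleCover),
      (∀ h, Φ (SemidirectProduct.inl h) = liftB hΓ (ψ.symm h)) ∧
      Φ (xElt σ hσ) = swapB Γ := by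
  have hγ : ∀ h, ψ.symm (σ h) = gamma hΓ (ψ.symm h) := fun h => by
    rw [hψ h, MulEquiv.symm_apply_apply]
  let s : Multiplicative (ZMod 2) →* (Γ.bipartiteDoubleCover ≃g Γ.bipartiteDoubleCover) :=
    { toFun := fun z => swapB Γ ^ (Multiplicative.toAdd z).val
      map_one' := pow_zero _
      map_mul' := fun a b => by
        rw [← pow_add, toAdd_mul, ZMod.val_add]
        exact (pow_eq_pow_mod _ ((pow_two _).trans swapB_mul_swapB)).symm }
  have hs : s (Multiplicative.ofAdd 1) = swapB Γ := pow_one _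
  have h2 : ∀ t : Multiplicative (ZMod 2), t = 1 ∨ t = Multiplicative.ofAdd 1 := by decide
  let Φ : HZ2 σ hσ →* (Γ.bipartiteDoubleCover ≃g Γ.bipartiteDoubleCover) :=
    SemidirectProduct.lift ((liftHom hΓ).comp ψ.symm.toMonoidHom) s (by
      intro t
      ext1 h
      rcases h2 t with rfl | rfl
      · rw [map_one, map_one, map_one]
        rfl
      · rw [theta_ofAdd_one]
        simp only [MonoidHom.comp_apply, MulEquiv.coe_toMonoidHom, MulAut.conj_apply]
        rw [hs, hγ, eq_mul_inv_iff_mul_eq]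
        exact (swapB_mul_liftB hΓ _).symm)
  have hl : ∀ h, Φ (SemidirectProduct.inl h) = liftB hΓ (ψ.symm h) := fun h =>
    SemidirectProduct.lift_inl _ _ _ h
  have hx : Φ (xElt σ hσ) = swapB Γ := (SemidirectProduct.lift_inr _ _ _ _).trans hs
  refine ⟨MulEquiv.ofBijective Φ ⟨?_, ?_⟩, hl, hx⟩
  · rw [injective_iff_map_eq_one]
    intro z hz
    obtain ⟨v⟩ := (connected_of_bipartiteDoubleCover hB).nonempty
    obtain ⟨h, rfl | rfl⟩ := eq_inl_or_eq_inl_mul_xElt z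
    · rw [hl] at hz
      have : ψ.symm h = 1 := by
        ext v
        exact Sum.inl_injective (DFunLike.congr_fun hz (Sum.inl v))
      rw [(map_eq_one_iff _ ψ.symm.injective).1 this, map_one]
    · rw [map_mul, hl, hx] at hz
      have h3 := DFunLike.congr_fun hz (Sum.inl v)
      exact absurd h3 Sum.inr_ne_inl
  · intro g
    obtain ⟨π, rfl | rfl⟩ := exists_liftB_or_liftB_mul_swapB hΓ hB g
    · exact ⟨SemidirectProduct.inl (ψ π), by rw [hl, ψ.symm_apply_apply]⟩
    · exact ⟨SemidirectProduct.inl (ψ π) * xElt σ hσ, by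
        rw [map_mul, hl, hx, ψ.symm_apply_apply]⟩

end Semidirect

/-! ### Degrees of two-fold images -/

section Degree

variable {V : Type u} [Finite V] {Γ : SimpleGraph V}

theorem ncard_neighborSet_gammaPerm (hΓ : Reduced Γ) (π : autPi Γ) (v : V) :
    (Γ.neighborSet (gammaPerm hΓ π v)).ncard = (Γ.neighborSet v).ncard := by
  rw [← Set.ncard_image_of_injective (Γ.neighborSet v) (π : Equiv.Perm V).injective,
    image_neighborSet]
  rfl

theorem ncard_neighborSet_apply (hΓ : Reduced Γ) (π : autPi Γ) (v : V) :
    (Γ.neighborSet ((π : Equiv.Perm V) v)).ncard = (Γ.neighborSet v).ncard := by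
  rw [← gammaPerm_image hΓ, Set.ncard_image_of_injective _ (gammaPerm hΓ π).injective]

theorem exists_adj_apply_ncard_iff (hΓ : Reduced Γ) (π : autPi Γ) (v : V) (r : ℕ) :
    (∃ w, Γ.Adj ((π : Equiv.Perm V) v) w ∧ (Γ.neighborSet w).ncard = r) ↔
      ∃ w, Γ.Adj v w ∧ (Γ.neighborSet w).ncard = r := by
  rw [(gammaPerm hΓ π).surjective.exists]
  simp only [ncard_neighborSet_gammaPerm]
  exact exists_congr fun w => and_congr_left' (adj_iff π v w)

end Degree

/-! ### The colours and the voltage graph -/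

/-- The colours of the vertices: a clique of colours `c i`, colours `d j` which form a half graph
together with the clique, a colour `m` joined to the clique, and a pendant colour `e` at `m`. -/
inductive Colour (n : ℕ) : Type
  | c (i : Fin (n + 2))
  | d (j : Fin (n + 2))
  | m
  | e

namespace Colour

/-- The colours as a disjoint union. -/
def equivSum (n : ℕ) : Fin (n + 2) ⊕ Fin (n + 2) ⊕ Unit ⊕ Unit ≃ Colour n where
  toFun
    | .inl i => c i
    | .inr (.inl j) => d j
    | .inr (.inr (.inl _)) => m
    | .inr (.inr (.inr _)) => e
  invFun
    | c i => .inl i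
    | d j => .inr (.inl j)
    | m => .inr (.inr (.inl ()))
    | e => .inr (.inr (.inr ()))
  left_inv := by rintro (_ | _ | _ | _) <;> rfl
  right_inv := by rintro (_ | _ | _ | _) <;> rfl

instance (n : ℕ) : Fintype (Colour n) := Fintype.ofEquiv _ (equivSum n)

theorem sum_eq {n : ℕ} (f : Colour n → ℕ) :
    ∑ k, f k = ∑ i, f (c i) + (∑ j, f (d j) + (f m + f e)) := by
  rw [← (equivSum n).sum_comp]
  simp only [Fintype.sum_sum_type, Finset.univ_unique, Finset.sum_singleton]
  rfl

end Colour

open Colour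

/-- The properties of the set of all `g` such that `g x` is to move some vertex of `BΓ` to a
neighbour, in terms of `H` alone: every such `g x` is an involution, the set is closed under
conjugation by `H`, and it does not contain the exchange `x` of the two copies. -/
structure IsTwistedClosed {H : Type u} [Group H] (σ : MulAut H) (T : Set H) : Prop where
  mul_map_eq_one : ∀ g ∈ T, g * σ g = 1
  conj_mem : ∀ g ∈ T, ∀ h, h⁻¹ * g * σ h ∈ T
  one_notMem : 1 ∉ T

section Voltage

variable {H : Type u} [Group H] {n : ℕ}

/-- The voltages: the vertices `(h, k)` and `(h', k')` will be adjacent if and only if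
`h⁻¹ * σ h'` belongs to `voltage σ T a k k'`. -/
def voltage (σ : MulAut H) (T : Set H) (a : Fin (n + 2) → H) : Colour n → Colour n → Set H
  | c i, c j => if i = j then (if i = 0 then T else ∅) else {1}
  | c i, d j => if i ≤ j then {1} else ∅
  | d j, c i => if i ≤ j then {1} else ∅
  | m, c i => {a i}
  | c i, m => {(σ (a i))⁻¹}
  | m, e => {1}
  | e, m => {1}
  | d _, d _ => ∅
  | d _, m => ∅
  | d _, e => ∅
  | m, d _ => ∅
  | e, d _ => ∅
  | c _, e => ∅
  | e, c _ => ∅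
  | m, m => ∅
  | e, e => ∅

variable {σ : MulAut H} {T : Set H} {a : Fin (n + 2) → H}

theorem apply_apply_of_sq_eq_one (hσ : σ ^ 2 = 1) (h : H) : σ (σ h) = h := by
  rw [← MulAut.mul_apply, ← pow_two, hσ, MulAut.one_apply]

theorem voltage_symm (hσ : σ ^ 2 = 1) (hT : IsTwistedClosed σ T) {k k' : Colour n} {x : H}
    (hx : x ∈ voltage σ T a k k') : (σ x)⁻¹ ∈ voltage σ T a k' k := by
  have hTx : ∀ x ∈ T, (σ x)⁻¹ ∈ T := fun x hx => by
    rwa [← eq_inv_of_mul_eq_one_left (hT.mul_map_eq_one x hx)]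
  rcases k with i | j | _ | _ <;> rcases k' with i' | j' | _ | _ <;> simp only [voltage] at hx ⊢
  · rcases eq_or_ne i i' with rfl | h
    · rw [if_pos rfl] at hx ⊢
      split_ifs at hx ⊢
      · exact hTx x hx
      · exact hx.elim
    · rw [if_neg h] at hx
      rw [if_neg h.symm]
      simp_all
  all_goals first
    | exact hx.elim
    | (split_ifs at hx ⊢ <;> simp_all)
    | (simp_all [apply_apply_of_sq_eq_one hσ])

theorem voltage_self {k : Colour n} {x : H} :
    x ∈ voltage σ T a k k ↔ k = c 0 ∧ x ∈ T := by
  rcases k with i | j | _ | _ <;> simp only [voltage]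
  · by_cases h : i = 0 <;> simp [h]
  all_goals simp

theorem voltage_subsingleton {k k' : Colour n} (h : k ≠ k') :
    (voltage σ T a k k').Subsingleton := by
  rcases k with i | j | _ | _ <;> rcases k' with i' | j' | _ | _ <;> simp only [voltage]
  · rw [if_neg fun hi => h (congrArg c hi)]
    exact Set.subsingleton_singleton
  all_goals first
    | exact Set.subsingleton_empty
    | exact Set.subsingleton_singleton
    | (split_ifs <;> simp)

/-- The graph on `H × Colour n` given by the voltages. Left multiplication by `g` on one side and
by `σ g` on the other side preserves its adjacency relation. -/
def voltageGraph (hσ : σ ^ 2 = 1) (hT : IsTwistedClosed σ T) (a : Fin (n + 2) → H) :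
    SimpleGraph (H × Colour n) where
  Adj v w := v.1⁻¹ * σ w.1 ∈ voltage σ T a v.2 w.2
  symm := ⟨fun v w h => by
    have := voltage_symm hσ hT h
    rwa [map_mul, apply_apply_of_sq_eq_one hσ, mul_inv_rev, map_inv, inv_inv] at this⟩
  loopless := ⟨fun v h => by
    -- A loop would put a twisted conjugate of `1` into `T`.
    have := hT.conj_mem _ (voltage_self.1 h).2 v.1⁻¹
    rw [inv_inv, mul_inv_cancel_left, ← map_mul, mul_inv_cancel, map_one] at this
    exact hT.one_notMem this⟩

theorem voltageGraph_adj {hσ : σ ^ 2 = 1} {hT : IsTwistedClosed σ T} {v w : H × Colour n} :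
    (voltageGraph hσ hT a).Adj v w ↔ v.1⁻¹ * σ w.1 ∈ voltage σ T a v.2 w.2 := Iff.rfl

theorem voltageGraph_adj_of_mem (hσ : σ ^ 2 = 1) (hT : IsTwistedClosed σ T) {k k' : Colour n}
    {x : H} (hx : x ∈ voltage σ T a k k') (h : H) :
    (voltageGraph hσ hT a).Adj (h, k) (σ (h * x), k') := by
  rwa [voltageGraph_adj, apply_apply_of_sq_eq_one hσ, inv_mul_cancel_left]

/-- A function on the vertices of `BΓ` which is constant on the edges joining distinct colours is
constant. This gives both the connectedness of `BΓ` and the rigidity of its colour-preserving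
automorphisms. -/
theorem eq_of_adj_voltageGraph (hσ : σ ^ 2 = 1) (hT : IsTwistedClosed σ T)
    (ha : Function.Surjective a) {X : Type*} {F : (H × Colour n) ⊕ (H × Colour n) → X}
    (hF : ∀ v w, (voltageGraph hσ hT a).Adj v w → v.2 ≠ w.2 → F (Sum.inl v) = F (Sum.inr w))
    (p q : (H × Colour n) ⊕ (H × Colour n)) : F p = F q := by
  have edge : ∀ {k k' : Colour n} {x : H}, k ≠ k' → x ∈ voltage σ T a k k' → ∀ h,
      F (Sum.inl (h, k)) = F (Sum.inr (σ (h * x), k')) := fun hk hx h =>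
    hF _ _ (voltageGraph_adj_of_mem hσ hT hx h) hk
  have edge1 : ∀ {k k' : Colour n}, k ≠ k' → 1 ∈ voltage σ T a k k' → ∀ h,
      F (Sum.inl (h, k)) = F (Sum.inr (σ h, k')) := fun hk hx h => by
    rw [edge hk hx, mul_one]
  have hcd : ∀ i j h, i ≤ j → F (Sum.inl (h, c i)) = F (Sum.inr (σ h, d j)) :=
    fun i j h hij => edge1 (k := c i) (k' := d j) nofun (by simp [voltage, hij]) h
  have hdc : ∀ i j h, i ≤ j → F (Sum.inl (h, d j)) = F (Sum.inr (σ h, c i)) :=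
    fun i j h hij => edge1 (k := d j) (k' := c i) nofun (by simp [voltage, hij]) h
  have hcc : ∀ h, F (Sum.inl (h, c 0)) = F (Sum.inr (σ h, c 1)) :=
    edge1 (by simp) (by simp [voltage])
  set Y : H → X := fun h => F (Sum.inl (h, c 0))
  have hd1 : ∀ j h, F (Sum.inr (σ h, d j)) = Y h := fun j h => (hcd 0 j h (Fin.zero_le _)).symm
  have hc0 : ∀ i h, F (Sum.inl (h, c i)) = Y h := fun i h => by
    rw [hcd i _ h (Fin.le_last i), hd1]
  have hd0 : ∀ j h, F (Sum.inl (h, d j)) = Y h := fun j h => by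
    rw [hdc 0 j h (Fin.zero_le _), ← hdc 0 _ h (Fin.zero_le (Fin.last (n + 1))),
      hdc 1 _ h (Fin.le_last 1), ← hcc]
  have hc1 : ∀ i h, F (Sum.inr (σ h, c i)) = Y h := fun i h => by
    rw [← hdc i _ h (Fin.le_last i), hd0]
  have hm0 : ∀ i h, F (Sum.inl (h, m)) = Y (h * a i) := fun i h => by
    rw [edge (k := m) (k' := c i) (x := a i) nofun (by simp [voltage]), hc1]
  have hYc : ∀ h, Y h = Y 1 := fun h => by
    obtain ⟨i, hi⟩ := ha h
    obtain ⟨j, hj⟩ := ha 1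
    rw [← one_mul h, ← hi, ← hm0, hm0 j, hj, mul_one]
  have hm1 : ∀ h, F (Sum.inr (σ h, m)) = Y 1 := fun h => by
    rw [← hYc (h * σ (a 0)), ← hc0 0,
      edge (k := c 0) (k' := m) (x := (σ (a 0))⁻¹) nofun (by simp [voltage]), mul_inv_cancel_right]
  have key : ∀ h k, F (Sum.inl (h, k)) = Y 1 ∧ F (Sum.inr (σ h, k)) = Y 1 := by
    rintro h (i | j | _ | _)
    · exact ⟨(hc0 i h).trans (hYc h), (hc1 i h).trans (hYc h)⟩
    · exact ⟨(hd0 j h).trans (hYc h), (hd1 j h).trans (hYc h)⟩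
    · exact ⟨(hm0 0 h).trans (hYc _), hm1 h⟩
    · refine ⟨?_, ?_⟩
      · rw [edge1 (k := e) (k' := m) nofun (by simp [voltage]), hm1]
      · rw [← edge1 (k := m) (k' := e) nofun (by simp [voltage]), hm0 0, hYc]
  have all : ∀ p, F p = Y 1 := by
    rintro (⟨h, k⟩ | ⟨h, k⟩)
    · exact (key h k).1
    · rw [← apply_apply_of_sq_eq_one hσ h]
      exact (key _ k).2
  rw [all p, all q]

theorem bipartiteDoubleCover_voltageGraph_connected (hσ : σ ^ 2 = 1)
    (hT : IsTwistedClosed σ T) (ha : Function.Surjective a) :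
    (voltageGraph hσ hT a).bipartiteDoubleCover.Connected := by
  have : Nonempty (H × Colour n) := ⟨(1, m)⟩
  refine ⟨fun p q => SimpleGraph.ConnectedComponent.exact ?_⟩
  exact eq_of_adj_voltageGraph hσ hT ha
    (F := (voltageGraph hσ hT a).bipartiteDoubleCover.connectedComponentMk)
    (fun v w h _ => SimpleGraph.ConnectedComponent.sound
      (SimpleGraph.Adj.reachable (bipartiteDoubleCover_adj_inl_inr.2 h))) p q

theorem voltageGraph_not_isBipartite (hσ : σ ^ 2 = 1) (hT : IsTwistedClosed σ T)
    (a : Fin (n + 2) → H) : ¬ (voltageGraph hσ hT a).IsBipartite := by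
  rintro ⟨f⟩
  -- The vertices of colours `c 0`, `c 1` and `d 1` over `1` form a triangle.
  have h1 := f.valid (v := (1, c 0)) (w := (1, c 1)) (by simp [voltageGraph_adj, voltage])
  have h2 := f.valid (v := (1, c 0)) (w := (1, d 1)) (by simp [voltageGraph_adj, voltage])
  have h3 := f.valid (v := (1, c 1)) (w := (1, d 1)) (by simp [voltageGraph_adj, voltage])
  omega

/-! ### Recognizing the colours by degrees -/

/-- The degree of a vertex of the given colour in the voltage graph. -/
noncomputable def colourDegree (T : Set H) : Colour n → ℕ
  | c i => 2 * (n + 2) - i + if i = 0 then T.ncard else 0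
  | d j => j + 1
  | m => n + 3
  | e => 1

theorem sum_ncard_voltage (k : Colour n) :
    ∑ k', (voltage σ T a k k').ncard = colourDegree T k := by
  have key1 : ∀ i : Fin (n + 2), ∑ j, (if i ≤ j then ({1} : Set H) else ∅).ncard
      = n + 2 - i := fun i => by
    simp only [apply_ite Set.ncard, Set.ncard_singleton, Set.ncard_empty, Finset.sum_boole]
    rw [Finset.filter_le_eq_Ici]
    simp
  have key2 : ∀ j : Fin (n + 2), ∑ i, (if i ≤ j then ({1} : Set H) else ∅).ncard
      = j + 1 := fun j => by
    simp only [apply_ite Set.ncard, Set.ncard_singleton, Set.ncard_empty, Finset.sum_boole]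
    rw [Finset.filter_ge_eq_Iic]
    simp
  have key3 : ∀ i : Fin (n + 2),
      ∑ j, (if i = j then (if i = 0 then T else ∅) else ({1} : Set H)).ncard
        = n + 1 + if i = 0 then T.ncard else 0 := fun i => by
    rw [← Finset.add_sum_erase _ _ (Finset.mem_univ i), Finset.sum_congr rfl
      (g := fun _ => 1) (fun j hj => by
        rw [if_neg (Finset.ne_of_mem_erase hj).symm, Set.ncard_singleton])]
    simp [apply_ite Set.ncard, add_comm]
  rw [sum_eq]
  rcases k with i | j | _ | _ <;> simp only [voltage, colourDegree, key1, key2, key3] <;> simp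
  omega

variable [Finite H]

theorem ncard_neighborSet_voltageGraph (hσ : σ ^ 2 = 1) (hT : IsTwistedClosed σ T)
    (v : H × Colour n) :
    ((voltageGraph hσ hT a).neighborSet v).ncard = colourDegree T v.2 := by
  rw [← sum_ncard_voltage (σ := σ) (a := a)]
  have E : (voltageGraph hσ hT a).neighborSet v ≃ Σ k, voltage σ T a v.2 k :=
    { toFun := fun w => ⟨w.1.2, v.1⁻¹ * σ w.1.1, w.2⟩
      invFun := fun x => ⟨(σ (v.1 * x.2.1), x.1), voltageGraph_adj_of_mem hσ hT x.2.2 v.1⟩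
      left_inv := fun w => by
        ext <;> simp [apply_apply_of_sq_eq_one hσ]
      right_inv := fun ⟨k, x, hx⟩ => by
        simp [apply_apply_of_sq_eq_one hσ] }
  rw [← Nat.card_coe_set_eq, Nat.card_congr E, Nat.card_sigma]
  rfl

omit [Finite H] in
theorem exists_adj_voltageGraph_iff (hσ : σ ^ 2 = 1) (hT : IsTwistedClosed σ T)
    (v : H × Colour n) (P : Colour n → Prop) :
    (∃ w, (voltageGraph hσ hT a).Adj v w ∧ P w.2) ↔
      ∃ k, (voltage σ T a v.2 k).Nonempty ∧ P k := by
  constructor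
  · rintro ⟨w, hw, hP⟩
    exact ⟨w.2, ⟨_, hw⟩, hP⟩
  · rintro ⟨k, ⟨x, hx⟩, hP⟩
    exact ⟨_, voltageGraph_adj_of_mem hσ hT hx v.1, hP⟩

omit [Finite H] in
/-- Among the colours only the pairs `m`, `c (n + 1)` and `d 0`, `e` have equal degrees. In the
first pair only `m` has a neighbour of degree one, and in the second pair only `e` has a neighbour
of the degree of `m`. -/
theorem colour_eq_of_colourDegree_eq {k k' : Colour n}
    (hd : colourDegree T k = colourDegree T k')
    (hN : ∀ r, (∃ l, (voltage σ T a k l).Nonempty ∧ colourDegree T l = r) ↔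
      ∃ l, (voltage σ T a k' l).Nonempty ∧ colourDegree T l = r) : k = k' := by
  have hm : ∃ l, (voltage σ T a m l).Nonempty ∧ colourDegree T l = 1 :=
    ⟨e, ⟨1, rfl⟩, rfl⟩
  have he : ∃ l, (voltage σ T a e l).Nonempty ∧ colourDegree T l = n + 3 :=
    ⟨m, ⟨1, rfl⟩, rfl⟩
  have hc : ∀ i : Fin (n + 2), (i : ℕ) ≠ 0 →
      ¬ ∃ l, (voltage σ T a (c i) l).Nonempty ∧ colourDegree T l = 1 := by
    rintro i hi ⟨l | j | _ | _, h1, h2⟩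
    · simp only [colourDegree] at h2
      omega
    · simp only [colourDegree] at h2
      have : ¬ i ≤ j := by omega
      simp [voltage, this] at h1
    · simp [colourDegree] at h2
    · simp [voltage] at h1
  have hd0 : ∀ j : Fin (n + 2), (j : ℕ) = 0 →
      ¬ ∃ l, (voltage σ T a (d j) l).Nonempty ∧ colourDegree T l = n + 3 := by
    rintro j hj ⟨i | j | _ | _, h1, h2⟩
    · obtain rfl : j = 0 := Fin.ext hj
      have hi : i = 0 := by
        by_contra hi
        simp [voltage, hi] at h1
      simp only [colourDegree, hi] at h2
      simp at h2
      omega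
    all_goals simp [voltage] at h1
  rcases k with i | j | _ | _ <;> rcases k' with i' | j' | _ | _
  · refine congrArg c ?_
    simp only [colourDegree, Fin.ext_iff, Fin.val_zero] at hd ⊢
    split_ifs at hd <;> omega
  · simp only [colourDegree] at hd
    omega
  · simp only [colourDegree] at hd
    exact absurd ((hN 1).2 hm) (hc i (by
      intro h0
      rw [if_pos (Fin.ext h0), h0] at hd
      omega))
  · simp only [colourDegree] at hd
    omega
  · simp only [colourDegree] at hd
    omega
  · refine congrArg d ?_
    simp only [colourDegree] at hd
    omega
  · simp only [colourDegree] at hd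
    omega
  · simp only [colourDegree] at hd
    exact absurd ((hN _).2 he) (hd0 j (by omega))
  · simp only [colourDegree] at hd
    exact absurd ((hN 1).1 hm) (hc i' (by
      intro h0
      rw [if_pos (Fin.ext h0), h0] at hd
      omega))
  · simp only [colourDegree] at hd
    omega
  · rfl
  · simp [colourDegree] at hd
  · simp only [colourDegree] at hd
    omega
  · simp only [colourDegree] at hd
    exact absurd ((hN _).1 he) (hd0 j' (by omega))
  · simp [colourDegree] at hd
  · rfl

theorem snd_eq_of_ncard_neighborSet_eq (hσ : σ ^ 2 = 1) (hT : IsTwistedClosed σ T)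
    {v w : H × Colour n}
    (hd : ((voltageGraph hσ hT a).neighborSet v).ncard =
      ((voltageGraph hσ hT a).neighborSet w).ncard)
    (hN : ∀ r, (∃ u, (voltageGraph hσ hT a).Adj v u ∧
        ((voltageGraph hσ hT a).neighborSet u).ncard = r) ↔
      ∃ u, (voltageGraph hσ hT a).Adj w u ∧
        ((voltageGraph hσ hT a).neighborSet u).ncard = r) : v.2 = w.2 := by
  simp only [ncard_neighborSet_voltageGraph] at hd hN
  refine colour_eq_of_colourDegree_eq (σ := σ) (a := a) hd fun r => ?_
  have := hN r
  rwa [exists_adj_voltageGraph_iff hσ hT v fun k => colourDegree T k = r,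
    exists_adj_voltageGraph_iff hσ hT w fun k => colourDegree T k = r] at this

theorem voltageGraph_reduced (hσ : σ ^ 2 = 1) (hT : IsTwistedClosed σ T)
    (a : Fin (n + 2) → H) : Reduced (voltageGraph hσ hT a) := by
  intro v w h
  have hadj : ∀ u, (voltageGraph hσ hT a).Adj v u ↔ (voltageGraph hσ hT a).Adj w u :=
    fun u => Set.ext_iff.1 h u
  have hk : v.2 = w.2 :=
    snd_eq_of_ncard_neighborSet_eq hσ hT (by rw [h]) fun r => by simp only [hadj]
  obtain ⟨k, hne, x, hx⟩ : ∃ k, v.2 ≠ k ∧ (voltage σ T a v.2 k).Nonempty := by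
    rcases v.2 with i | j | _ | _
    · exact ⟨m, nofun, _, rfl⟩
    · exact ⟨c 0, nofun, 1, by simp [voltage]⟩
    · exact ⟨e, nofun, 1, rfl⟩
    · exact ⟨m, nofun, 1, rfl⟩
  have hv := voltageGraph_adj_of_mem hσ hT hx v.1
  have := voltage_subsingleton (hk ▸ hne) (hk ▸ voltageGraph_adj.1 hv)
    (voltageGraph_adj.1 ((hadj _).1 hv))
  exact Prod.ext (inv_injective (mul_right_cancel this)) hk

/-! ### The two-fold projections of the voltage graph -/

omit [Finite H] in
theorem voltageGraph_adj_mul_left (hσ : σ ^ 2 = 1) (hT : IsTwistedClosed σ T) (g : H)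
    (v w : H × Colour n) :
    (voltageGraph hσ hT a).Adj (g * v.1, v.2) (σ g * w.1, w.2) ↔
      (voltageGraph hσ hT a).Adj v w := by
  rw [voltageGraph_adj, voltageGraph_adj, map_mul, apply_apply_of_sq_eq_one hσ, mul_inv_rev,
    mul_assoc, inv_mul_cancel_left]

theorem snd_apply_autPi (hσ : σ ^ 2 = 1) (hT : IsTwistedClosed σ T)
    (π : autPi (voltageGraph hσ hT a)) (v : H × Colour n) :
    ((π : Equiv.Perm (H × Colour n)) v).2 = v.2 :=
  snd_eq_of_ncard_neighborSet_eq hσ hT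
    (ncard_neighborSet_apply (voltageGraph_reduced hσ hT a) π v)
    (exists_adj_apply_ncard_iff (voltageGraph_reduced hσ hT a) π v)

/-- Every two-fold projection of the voltage graph is a left multiplication. -/
theorem exists_apply_autPi_eq (hσ : σ ^ 2 = 1) (hT : IsTwistedClosed σ T)
    (ha : Function.Surjective a) (π : autPi (voltageGraph hσ hT a)) :
    ∃ g : H, ∀ v, (π : Equiv.Perm (H × Colour n)) v = (g * v.1, v.2) := by
  set α : Equiv.Perm (H × Colour n) := π.1 with hα
  set β : Equiv.Perm (H × Colour n) := (gamma (voltageGraph_reduced hσ hT a) π).1 with hβ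
  -- `π` preserves the voltage of an edge joining distinct colours, as this voltage is determined
  -- by the colours. Hence the quotients `h' * h⁻¹` agree at its ends, up to `σ` on the second part.
  have hF := eq_of_adj_voltageGraph hσ hT ha
    (F := Sum.elim (fun v => (α v).1 * v.1⁻¹) (fun w => σ ((β w).1 * w.1⁻¹)))
    (fun v w hvw hne => by
      have h1 := voltageGraph_adj.1 ((adj_iff π v w).2 hvw)
      have h2 : (α v).1⁻¹ * σ (β w).1 ∈ voltage σ T a (α v).2 (β w).2 := h1
      rw [hα, hβ, snd_apply_autPi, snd_apply_autPi, ← hα, ← hβ] at h2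
      have h3 := voltage_subsingleton hne h2 (voltageGraph_adj.1 hvw)
      simp only [Sum.elim_inl, Sum.elim_inr, map_mul, map_inv]
      rw [inv_mul_eq_iff_eq_mul] at h3
      rw [h3]
      group)
  refine ⟨(α (1, m)).1, fun v => Prod.ext ?_ (snd_apply_autPi hσ hT π v)⟩
  have := hF (Sum.inl v) (Sum.inl (1, m))
  simp only [Sum.elim_inl, inv_one, mul_one] at this
  exact eq_mul_of_mul_inv_eq this

/-- `H ≅ Aut^π(Γ)` for the voltage graph `Γ`, where `g` acts by left multiplication. -/
theorem exists_mulEquiv_autPi_voltageGraph (hσ : σ ^ 2 = 1) (hT : IsTwistedClosed σ T)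
    (ha : Function.Surjective a) :
    ∃ φ : H ≃* autPi (voltageGraph hσ hT a),
      (∀ g v, (φ g : Equiv.Perm (H × Colour n)) v = (g * v.1, v.2)) ∧
      ∀ g, gamma (voltageGraph_reduced hσ hT a) (φ g) = φ (σ g) := by
  let L : H → Equiv.Perm (H × Colour n) := fun g =>
    (Equiv.mulLeft g).prodCongr (Equiv.refl _)
  have hL : ∀ g v, L g v = (g * v.1, v.2) := fun _ _ => rfl
  have hadj : ∀ g v w, (voltageGraph hσ hT a).Adj (L g v) (L (σ g) w) ↔
      (voltageGraph hσ hT a).Adj v w := voltageGraph_adj_mul_left hσ hT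
  let φ : H →* autPi (voltageGraph hσ hT a) :=
    { toFun := fun g => ⟨L g, mem_autPi_of_adj (hadj g)⟩
      map_one' := by
        ext1
        ext v : 1
        exact Prod.ext (one_mul v.1) rfl
      map_mul' := fun g h => by
        ext1
        ext v : 1
        exact Prod.ext (mul_assoc g h v.1) rfl }
  have hφ : ∀ g v, (φ g : Equiv.Perm (H × Colour n)) v = (g * v.1, v.2) := fun _ _ => rfl
  refine ⟨MulEquiv.ofBijective φ ⟨fun g h hgh => ?_, fun π => ?_⟩, hφ, fun g => ?_⟩
  · have := congrArg (fun π => ((π : autPi _) : Equiv.Perm (H × Colour n)) (1, m)) hgh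
    simp only [hφ, mul_one] at this
    exact (Prod.ext_iff.1 this).1
  · obtain ⟨g, hg⟩ := exists_apply_autPi_eq hσ hT ha π
    refine ⟨g, ?_⟩
    ext1
    ext v : 1
    rw [hφ, hg]
  · ext1
    exact gamma_eq_of_adj _ _ (hadj g)

end Voltage

/-! ### Strongly switching elements of the voltage graph -/

section Switching

open Colour

variable {H : Type u} [Group H] {σ : MulAut H}

theorem inl_mul_xElt_sq_eq_one_iff {hσ : σ ^ 2 = 1} {g : H} :
    (SemidirectProduct.inl g * xElt σ hσ) ^ 2 = 1 ↔ g * σ g = 1 := by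
  rw [pow_two, mul_assoc, ← mul_assoc (xElt σ hσ), xElt_mul_inl, mul_assoc, xElt_mul_xElt,
    mul_one, ← map_mul, map_eq_one_iff _ SemidirectProduct.inl_injective]

theorem conj_mem_of_isSumOfConjClasses {G : Type u} [Group G] {C : Set G}
    (hC : IsSumOfConjClasses C) {g : G} (hg : g ∈ C) (k : G) : k * g * k⁻¹ ∈ C := by
  obtain ⟨K, rfl⟩ := hC
  obtain ⟨c, hc, hgc⟩ := Set.mem_iUnion₂.1 hg
  refine Set.mem_iUnion₂.2 ⟨c, hc, ?_⟩
  rw [ConjClasses.mem_carrier_iff_mk_eq] at hgc ⊢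
  rw [← hgc, ConjClasses.mk_eq_mk_iff_isConj]
  exact (isConj_iff.2 ⟨k, rfl⟩).symm

/-- The elements `g` for which `g x` is an involution outside of `C`. -/
def complementSet (hσ : σ ^ 2 = 1) (C : Set (HZ2 σ hσ)) : Set H :=
  {g | g * σ g = 1 ∧ SemidirectProduct.inl g * xElt σ hσ ∉ C}

theorem isTwistedClosed_complementSet (hσ : σ ^ 2 = 1) {C : Set (HZ2 σ hσ)}
    (hC : IsSumOfConjClasses C) (hx : xElt σ hσ ∈ C) :
    IsTwistedClosed σ (complementSet hσ C) where
  mul_map_eq_one _ hg := hg.1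
  conj_mem g hg h := by
    have key : SemidirectProduct.inl (h⁻¹ * g * σ h) * xElt σ hσ =
        (SemidirectProduct.inl h)⁻¹ * (SemidirectProduct.inl g * xElt σ hσ) *
          SemidirectProduct.inl h := by
      rw [map_mul, mul_assoc, ← xElt_mul_inl, map_mul, map_inv]
      simp only [mul_assoc]
    refine ⟨?_, fun hmem => hg.2 ?_⟩
    · rw [map_mul, map_mul, apply_apply_of_sq_eq_one hσ, map_inv]
      have : h⁻¹ * g * σ h * ((σ h)⁻¹ * σ g * h) = h⁻¹ * (g * σ g) * h := by group
      rw [this, hg.1, mul_one, inv_mul_cancel]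
    · have := conj_mem_of_isSumOfConjClasses hC hmem (SemidirectProduct.inl h)
      rw [key] at this
      simpa only [mul_assoc, mul_inv_cancel_left, mul_inv_cancel, mul_one] using this
  one_notMem h := h.2 (by rwa [map_one, one_mul])

variable [Finite H] {n : ℕ} {T : Set H} {a : Fin (n + 2) → H}

theorem liftB_not_mem_stronglySwitching {V : Type u} [Finite V] [Nonempty V]
    {Γ : SimpleGraph V} (hΓ : Reduced Γ) (π : autPi Γ) :
    liftB hΓ π ∉ stronglySwitching Γ := by
  rintro ⟨⟨_, h, _⟩, _⟩
  obtain ⟨w, hw⟩ := h (Classical.arbitrary V)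
  exact Sum.inl_ne_inr hw

/-- The automorphism `g x` moves some vertex of `BΓ` to a neighbour if and only if `g` is in `T`:
the only vertices which can be moved to a neighbour are those of colour `c 0`. -/
theorem liftB_mul_swapB_mem_stronglySwitching_iff (hσ : σ ^ 2 = 1) (hT : IsTwistedClosed σ T)
    {π : autPi (voltageGraph hσ hT a)} {g : H}
    (hπ : ∀ v, (π : Equiv.Perm (H × Colour n)) v = (g * v.1, v.2))
    (hγ : ∀ v, (gamma (voltageGraph_reduced hσ hT a) π : Equiv.Perm (H × Colour n)) v =
      (σ g * v.1, v.2))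
    (hg : g * σ g = 1) :
    liftB (voltageGraph_reduced hσ hT a) π * swapB _ ∈
      stronglySwitching (voltageGraph hσ hT a) ↔ g ∉ T := by
  have hinl : ∀ v, (liftB (voltageGraph_reduced hσ hT a) π * swapB (voltageGraph hσ hT a))
      (Sum.inl v) =
      Sum.inr (σ g * v.1, v.2) := fun v => by
    rw [RelIso.mul_apply, swapB_inl, liftB_inr, hγ]
  have hinr : ∀ v, (liftB (voltageGraph_reduced hσ hT a) π * swapB (voltageGraph hσ hT a))
      (Sum.inr v) =
      Sum.inl (g * v.1, v.2) := fun v => by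
    rw [RelIso.mul_apply, swapB_inr, liftB_inl, hπ]
  have hg' : σ g * g = 1 := by rw [← mul_eq_one_comm]; exact hg
  have hadj : ∀ v : H × Colour n, (voltageGraph hσ hT a).Adj v (σ g * v.1, v.2) ↔
      v.2 = c 0 ∧ v.1⁻¹ * g * σ v.1 ∈ T := fun v => by
    rw [voltageGraph_adj, voltage_self, map_mul, apply_apply_of_sq_eq_one hσ, mul_assoc]
  constructor
  · rintro ⟨_, h⟩ hgT
    refine h (Sum.inl (1, c 0)) ?_
    rw [hinl, SimpleGraph.mem_neighborSet, bipartiteDoubleCover_adj_inl_inr]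
    exact (hadj (1, c 0)).2 ⟨rfl, by simpa using hgT⟩
  · intro hgT
    -- A neighbour of colour `c 0` would give a twisted conjugate of `g` in `T`.
    have hnot : ∀ v : H × Colour n, ¬ (voltageGraph hσ hT a).Adj v (σ g * v.1, v.2) :=
        fun v hv => hgT (by
      have := hT.conj_mem _ ((hadj v).1 hv).2 v.1⁻¹
      rwa [inv_inv, map_inv, mul_assoc v.1⁻¹, mul_inv_cancel_left, mul_inv_cancel_right] at this)
    refine ⟨⟨orderOf_eq_prime ?_ fun h1 => ?_, fun v => ⟨_, hinl v⟩, fun v => ⟨_, hinr v⟩⟩, ?_⟩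
    · ext (v | v) : 1
      · rw [pow_two, RelIso.mul_apply, hinl, hinr, ← mul_assoc, hg, one_mul]
        rfl
      · rw [pow_two, RelIso.mul_apply, hinr, hinl, ← mul_assoc, hg', one_mul]
        rfl
    · have := hinl (1, m)
      rw [h1] at this
      exact Sum.inl_ne_inr this
    · rintro (v | v)
      · rw [hinl, SimpleGraph.mem_neighborSet, bipartiteDoubleCover_adj_inl_inr]
        exact hnot v
      · rw [hinr, SimpleGraph.mem_neighborSet, bipartiteDoubleCover_adj_inr_inl,
          SimpleGraph.adj_comm]
        have := hnot (g * v.1, v.2)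
        rwa [← mul_assoc, hg', one_mul] at this

end Switching

end TwoFold

open TwoFold in
theorem mainTheorem6 {H : Type u} [Group H] [Finite H] (σ : MulAut H) (hσ : σ ^ 2 = 1)
    (C : Set (TwoFold.HZ2 σ hσ)) (hCS : C ⊆ TwoFold.S σ hσ)
    (hC : TwoFold.IsSumOfConjClasses C) (hx : TwoFold.xElt σ hσ ∈ C) :
    TwoFold.Achievable σ hσ C := by
  have hT := isTwistedClosed_complementSet hσ hC hx
  -- The colours `c i` need at least two indices, also for the trivial group `H`.
  obtain ⟨n, ⟨f⟩⟩ : ∃ n, Nonempty (H ↪ Fin (n + 2)) :=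
    ⟨Nat.card H, ⟨(Finite.equivFin H).toEmbedding.trans (Fin.castAddEmb 2)⟩⟩
  have ha : Function.Surjective (Function.invFun f) := Function.invFun_surjective f.injective
  have hΓ := voltageGraph_reduced hσ hT (Function.invFun f)
  have hB := bipartiteDoubleCover_voltageGraph_connected hσ hT ha
  have : Nonempty (H × Colour n) := ⟨(1, Colour.m)⟩
  obtain ⟨φ, hφ, hγ⟩ := exists_mulEquiv_autPi_voltageGraph hσ hT ha
  have hψ : Intertwines σ hΓ φ.symm := fun h => by
    rw [MulEquiv.symm_symm, hγ, MulEquiv.symm_apply_apply]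
  obtain ⟨Φ, hl, hs⟩ := exists_mulEquiv_aut_bipartiteDoubleCover hΓ hB φ.symm hψ (hσ := hσ)
  refine ⟨H × Colour n, inferInstance, voltageGraph hσ hT (Function.invFun f),
    connected_of_bipartiteDoubleCover hB, hΓ, voltageGraph_not_isBipartite hσ hT _, hΓ, φ.symm,
    hψ, Φ.symm, fun π => ?_, ?_, ?_⟩
  · rw [MulEquiv.symm_apply_eq, hl, MulEquiv.symm_symm, MulEquiv.apply_symm_apply]
  · rw [MulEquiv.symm_apply_eq, hs]
  · ext z
    have hmem : z ∈ Φ.symm '' stronglySwitching (voltageGraph hσ hT (Function.invFun f)) ↔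
        Φ z ∈ stronglySwitching (voltageGraph hσ hT (Function.invFun f)) :=
      ⟨by rintro ⟨g, hg, rfl⟩; rwa [Φ.apply_symm_apply], fun h => ⟨_, h, Φ.symm_apply_apply z⟩⟩
    rw [hmem]
    obtain ⟨g, rfl | rfl⟩ := eq_inl_or_eq_inl_mul_xElt z
    · rw [hl]
      exact iff_of_false (liftB_not_mem_stronglySwitching hΓ _) fun h => (hCS h).1 ⟨g, rfl⟩
    · by_cases hg : g * σ g = 1
      · rw [map_mul, hl, hs, MulEquiv.symm_symm,
          liftB_mul_swapB_mem_stronglySwitching_iff hσ hT (hφ g)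
            (fun v => by rw [hγ, hφ]) hg]
        exact ⟨fun h => by_contra fun h' => h ⟨hg, h'⟩, fun h h' => h'.2 h⟩
      · refine iff_of_false (fun h => hg ?_) fun h =>
          hg (inl_mul_xElt_sq_eq_one_iff.1 (hCS h).2)
        rw [← inl_mul_xElt_sq_eq_one_iff (hσ := hσ)]
        apply Φ.injective
        rw [map_pow, map_one]
        exact orderOf_dvd_iff_pow_eq_one.1 h.1.1.dvd
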